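/- An \emph{alternating dimap} $G$ is a finite directed graph without isolated vertices, each component of which is 2-cell-embedded in its own oriented closed surface, such that around each vertex the edges are directed alternately in and out; it may be empty, and isomorphic alternating dimaps are identified. For each edge $e$, the left (right) successor of $e$ is the next edge after $e$ around its anticlockwise (clockwise) face. Let $\omega=e^{2\pi i/3}$. The reductions of $G$ at $e$ are: $G[1]e$, the contraction of $e$ as an embedded edge; $G[\omega]e$, in which the left successor of $e$ gets its tail moved to the tail of $e$ and $e$ is deleted; and $G[\omega^2]e$, the same with the right successor. The trial $G^\omega$ has the clockwise faces of $G$ as vertices; each edge $e$ gives an edge $e^\omega$ to the clockwise face containing $e$ from the clockwise face containing the left successor of $e$, drawn near the head of $e$. A class of alternating dimaps is \emph{minor-closed} if it contains all reductions of its members. Let $C_1$ be the ultraloop (the alternating dimap with one edge), $iC_1$ the disjoint union of $i$ copies of it, $\mathcal U_k=\{iC_1: 0\le i\le k\}$ and $\mathcal U_\infty=\{iC_1: i\ge 0\}$. A \emph{binary function} with finite ground set $E$ is a function $f:2^E\to\mathbb C$ with $f(\emptyset)=1$; write $f\simeq g$ if $f$ and $g$ agree up to a nonzero scalar factor (and a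 relabelling of the ground set). For $m=|E|$ let $L^{[\mu]}f=M(\mu)^{\otimes m}f$, where $$M(\mu)=\frac1{2\sqrt2}\begin{pmatrix}\sqrt2+1+(\sqrt2-1)\mu & 1-\mu\\ 1-\mu & \sqrt2-1+(\sqrt2+1)\mu\end{pmatrix},$$ and for $e\in E$ let the $[\mu]$-minor $f/\!/_{[\mu]}e$ be the binary function on $E\setminus\{e\}$ that is proportional to $X\mapsto f(X)+\lambda(\mu)f(X\cup\{e\})$, where $\lambda(\mu)=\dfrac{1+\mu}{\sqrt2+1-(\sqrt2-1)\mu}$. A \emph{strict binary representation} of a minor-closed class $\mathcal A$ is a triple $(F,\varepsilon,\nu)$, where $F$ assigns to each $G\in\mathcal A$ a binary function $F(G)$, $\varepsilon$ consists of bijections $\varepsilon_G$ from $E(G)$ to the ground set of $F(G)$, and $\nu\in\mathbb C$ has $|\nu|=1$, such that (1) for all $G\in\mathcal A$: $G^\omega\in\mathcal A$ and $F(G^\omega)\simeq L^{[\omega]}F(G)$; (2) $F(G[\mu]e)\simeq F(G)/\!/_{[\nu\mu]}\varepsilon_G(e)$ for all $G\in\mathcal A$, $e\in E(G)$ and $\mu\in\{1,\omega,\omega^2\}$;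 (3) $F$ is faithful: if $G,H\in\mathcal A$ and $F(G)\simeq F(H)$, then $G\cong H$. \textbf{Theorem.} If a minor-closed class $\mathcal A$ of alternating dimaps has a strict binary representation, then $\mathcal A=\emptyset$, or $\mathcal A=\mathcal U_k$ for some integer $k\ge0$, or $\mathcal A=\mathcal U_\infty$. Conversely, each of these classes is minor-closed and has a strict binary representation with $F(kC_1)=\begin{pmatrix}1\\ \sqrt2-1\end{pmatrix}^{\otimes k}$ for every $kC_1$ in the class, in which both relations $\simeq$ in (1) and (2) hold with the ground sets identified by the bijections $\varepsilon$. -/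

import Mathlib

universe u

/-- An alternating dimap, as a rotation system.  `E` is the finite set of edges.  `left e` and
`right e` are the left and right successors of `e`: the edges following `e` around its anticlockwise
face and around its clockwise face.  At the head of `e` they are the outgoing edges next to `e` in
clockwise and in anticlockwise order respectively, so going clockwise around a vertex one meets
`e` (in), `left e` (out), `right⁻¹ (left e)` (in), and so on, in and out alternating.  Any two
permutations of `E` arise from exactly one alternating dimap with edge set `E`: its vertices are the
orbits of this rotation, its anticlockwise faces the cycles of `left`, its clockwise faces the
cycles of `right`, and its components (each embedded in its own closed oriented surface) the
orbits of the group generated by `left` and `right`. -/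
structure AltDimap : Type (u + 1) where
  /-- the edges -/
  E : Type u
  finite : Finite E
  /-- left successor -/
  left : Equiv.Perm E
  /-- right successor -/
  right : Equiv.Perm E

/-- The three cube roots of unity `1`, `ω`, `ω²` that index the reductions. -/
inductive Triality : Type
  | one
  | omega
  | omegaSq

/-- The number `ω = exp(2πi/3)`. -/
noncomputable def cubeRoot : ℂ := Complex.exp (2 * Real.pi * Complex.I / 3)

/-- The complex number named by an index. -/
noncomputable def Triality.toComplex : Triality → ℂ
  | .one => 1
  | .omega => cubeRoot
  | .omegaSq => cubeRoot ^ 2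

open Classical in
/-- Skip the element `e` from its cycle in `σ`: the predecessor of `e` is sent to the
successor of `e`, and nothing else changes. -/
noncomputable def Equiv.Perm.skip {E : Type u} (σ : Equiv.Perm E) (e : E) :
    Equiv.Perm {x : E // x ≠ e} :=
  (Equiv.swap e (σ e) * σ).subtypePerm (by
    intro x
    have h : (Equiv.swap e (σ e) * σ) e = e := by simp
    rw [not_iff_not]
    constructor
    · intro hx
      exact (Equiv.swap e (σ e) * σ).injective (hx.trans h.symm)
    · rintro rfl
      exact h)

namespace AltDimap

/-- Isomorphism: a bijection between the edges that respects both successors. -/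
def IsIso (G H : AltDimap.{u}) : Prop :=
  ∃ φ : G.E ≃ H.E, (∀ e, φ (G.left e) = H.left (φ e)) ∧ ∀ e, φ (G.right e) = H.right (φ e)

/-- The next incoming edge after `e`, going clockwise around the head of `e`. -/
def nextIn (G : AltDimap.{u}) : Equiv.Perm G.E := G.right⁻¹ * G.left

/-- The reductions of `G` at the edge `e`.

`1` (contraction): `e` is shrunk, so each of the two faces at `e` just loses `e`.

`ω`: the left successor `f` of `e` has its tail moved to the place of the tail of `e`, and `e` is
deleted.  The anticlockwise face of `e` just loses `e`; as `f` and the other edges keep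
their heads, the cyclic order of the incoming edges at each vertex just loses `e`.  These two
permutations determine the right successors, since `right = left * nextIn⁻¹`.

`ω²`: the same with the right successor, where `left = right * nextIn`. -/
noncomputable def reduce (G : AltDimap.{u}) (μ : Triality) (e : G.E) : AltDimap.{u} where
  E := {x : G.E // x ≠ e}
  finite := haveI := G.finite; inferInstance
  left := match μ with
    | .one => G.left.skip e
    | .omega => G.left.skip e
    | .omegaSq => G.right.skip e * G.nextIn.skip e
  right := match μ with
    | .one => G.right.skip e
    | .omega => G.left.skip e * (G.nextIn.skip e)⁻¹
    | .omegaSq => G.right.skip e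

/-- The trial `G^ω`; the edge `e^ω` is again called `e`.  Its vertices are the clockwise faces
of `G`, and `e^ω` runs from the clockwise face of `left e` to the clockwise face of `e`,
near the head of `e`.  The edges entering a clockwise face are thus in the clockwise order given by
`right`, and the edges `e^ω` near one vertex of `G`, which run anticlockwise around it, form
an anticlockwise face of `G^ω`.  So `(G^ω).nextIn = G.right`, `(G^ω).left = G.nextIn⁻¹`, and hence
`(G^ω).right = (G^ω).left * ((G^ω).nextIn)⁻¹ = G.left⁻¹`. -/
def trial (G : AltDimap.{u}) : AltDimap.{u} where
  E := G.E
  finite := G.finite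
  left := G.nextIn⁻¹
  right := G.left⁻¹

/-- The ultraloop `C₁`: the alternating dimap with one edge. -/
def ultraloop : AltDimap.{u} where
  E := PUnit
  finite := inferInstance
  left := 1
  right := 1

/-- The disjoint union `kG` of `k` copies of `G`. -/
def copies (k : ℕ) (G : AltDimap.{u}) : AltDimap.{u} where
  E := Fin k × G.E
  finite := haveI := G.finite; inferInstance
  left := Equiv.prodCongr (Equiv.refl _) G.left
  right := Equiv.prodCongr (Equiv.refl _) G.right

end AltDimap

/-- A class of alternating dimaps (closed under isomorphism) that contains every minor of each
of its members; by iteration it is enough to ask this for single reductions. -/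
structure IsMinorClosed (A : Set AltDimap.{u}) : Prop where
  iso : ∀ {G H : AltDimap.{u}}, G ∈ A → G.IsIso H → H ∈ A
  reduce : ∀ {G : AltDimap.{u}}, G ∈ A → ∀ (μ : Triality) (e : G.E), G.reduce μ e ∈ A

/-- `𝒰_k = {0·C₁, 1·C₁, …, k·C₁}`, up to isomorphism. -/
def ultraloopClass (k : ℕ) : Set AltDimap.{u} :=
  {G | ∃ i ≤ k, G.IsIso (AltDimap.copies i AltDimap.ultraloop)}

/-- `𝒰_∞ = {i·C₁ | i = 0, 1, 2, …}`, up to isomorphism. -/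
def ultraloopClassInfinite : Set AltDimap.{u} :=
  {G | ∃ i : ℕ, G.IsIso (AltDimap.copies i AltDimap.ultraloop)}

/-- A binary function: a complex function on the subsets of a finite ground set that takes the
value `1` at the empty set. -/
structure BinaryFunction : Type (u + 1) where
  /-- the ground set -/
  E : Type u
  fintype : Fintype E
  /-- the values -/
  val : Finset E → ℂ
  val_empty : val ∅ = 1

attribute [instance] BinaryFunction.fintype

/-- `f ≃ g` when the ground set of `f` is identified with that of `g` by the bijection `σ`:
`f` is a nonzero scalar multiple of `g`. -/
def SimeqVia {D E : Type u} (σ : D ≃ E) (f : Finset D → ℂ) (g : Finset E → ℂ) : Prop :=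
  ∃ c : ℂ, c ≠ 0 ∧ ∀ X : Finset D, f X = c * g (X.map σ.toEmbedding)

/-- `f ≃ g`: equality up to a nonzero scalar and a relabelling of the ground set. -/
def Simeq {D E : Type u} (f : Finset D → ℂ) (g : Finset E → ℂ) : Prop :=
  ∃ σ : D ≃ E, SimeqVia σ f g

open Classical in
/-- The coordinate at `e` of the characteristic vector of `X`. -/
noncomputable def bit {E : Type u} (X : Finset E) (e : E) : Fin 2 := if e ∈ X then 1 else 0

/-- The matrix `M(μ)`. -/
noncomputable def transformMatrix (μ : ℂ) : Matrix (Fin 2) (Fin 2) ℂ :=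
  (1 / (2 * (√2 : ℂ))) •
    !![(√2 : ℂ) + 1 + ((√2 : ℂ) - 1) * μ, 1 - μ; 1 - μ, (√2 : ℂ) - 1 + ((√2 : ℂ) + 1) * μ]

/-- The number `λ(μ)`. -/
noncomputable def minorCoeff (μ : ℂ) : ℂ := (1 + μ) / ((√2 : ℂ) + 1 - ((√2 : ℂ) - 1) * μ)

namespace BinaryFunction

/-- The `μ`-transform `L^{[μ]} f = M(μ)^{⊗m} f`, where `m` is the size of the ground set. -/
noncomputable def transform (f : BinaryFunction.{u}) (μ : ℂ) (X : Finset f.E) : ℂ :=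
  ∑ Y : Finset f.E, (∏ e : f.E, transformMatrix μ (bit X e) (bit Y e)) * f.val Y

open Classical in
/-- The vector `(I₂^{⊗i} ⊗ (1 λ(μ)) ⊗ I₂^{⊗(m-i-1)}) f`, where `e` is the `i`-th element. -/
noncomputable def preMinor (f : BinaryFunction.{u}) (μ : ℂ) (e : f.E)
    (X : Finset {x : f.E // x ≠ e}) : ℂ :=
  f.val (X.map (Function.Embedding.subtype _)) +
    minorCoeff μ * f.val (insert e (X.map (Function.Embedding.subtype _)))

/-- The `[μ]`-minor of `f` by `e`: the scalar multiple of `preMinor` with value `1` at `∅`.  If there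
is none, this is the zero function, which is not `≃` to any binary function. -/
noncomputable def minor (f : BinaryFunction.{u}) (μ : ℂ) (e : f.E)
    (X : Finset {x : f.E // x ≠ e}) : ℂ :=
  (f.preMinor μ e ∅)⁻¹ * f.preMinor μ e X

end BinaryFunction

/-- A strict binary representation `(F, ε, ν)` of a minor-closed class `A`.

The ground sets of the two sides of `≃` are compared by an arbitrary bijection;
`IsEdgeCompatible` below says that the bijection induced by `ε` serves. -/
structure StrictBinaryRepresentation (A : Set AltDimap.{u}) (hA : IsMinorClosed A) where
  /-- the binary functions -/
  F : A → BinaryFunction.{u}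
  /-- the correspondence between edges and elements of the ground set -/
  ε : ∀ G : A, G.1.E ≃ (F G).E
  /-- the multiplier of the minor parameters -/
  ν : ℂ
  norm_ν : ‖ν‖ = 1
  /-- `F (G^ω)` has to be defined -/
  trial_mem : ∀ G : A, G.1.trial ∈ A
  /-- triality corresponds to the trinity transform -/
  trial : ∀ G : A, Simeq (F ⟨G.1.trial, trial_mem G⟩).val ((F G).transform cubeRoot)
  /-- reductions correspond to minors -/
  reduce : ∀ (G : A) (e : G.1.E) (μ : Triality),
    Simeq (F ⟨G.1.reduce μ e, hA.reduce G.2 μ e⟩).val ((F G).minor (ν * μ.toComplex) (ε G e))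
  /-- the representation is faithful: non-isomorphic members have images that differ even up to `≃` -/
  faithful : ∀ G H : A, Simeq (F G).val (F H).val → G.1.IsIso H.1

/-- Both correspondences hold with the ground sets identified through `ε`. -/
def StrictBinaryRepresentation.IsEdgeCompatible {A : Set AltDimap.{u}} {hA : IsMinorClosed A}
    (R : StrictBinaryRepresentation A hA) : Prop :=
  (∀ G : A, SimeqVia ((R.ε ⟨G.1.trial, R.trial_mem G⟩).symm.trans (R.ε G))
    (R.F ⟨G.1.trial, R.trial_mem G⟩).val ((R.F G).transform cubeRoot)) ∧
  ∀ (G : A) (e : G.1.E) (μ : Triality),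
    SimeqVia ((R.ε ⟨G.1.reduce μ e, hA.reduce G.2 μ e⟩).symm.trans
        ((R.ε G).subtypeEquiv (q := fun x => x ≠ R.ε G e)
          (fun _ => not_congr (R.ε G).injective.eq_iff.symm)))
      (R.F ⟨G.1.reduce μ e, hA.reduce G.2 μ e⟩).val
      ((R.F G).minor (R.ν * μ.toComplex) (R.ε G e))

/-- The class `A` is `∅`, or `𝒰_k` for some `k`, or `𝒰_∞`. -/
def IsUltraloopClass (A : Set AltDimap.{u}) : Prop :=
  A = ∅ ∨ (∃ k : ℕ, A = ultraloopClass k) ∨ A = ultraloopClassInfinite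

/-! A representable class contains only trivial dimaps, those with both successor permutations equal
to 1; this goes by induction on the number of edges (`StrictBinaryRepresentation.isTrivial`). With
two edges, every reduction leaves the unique dimap on the remaining edge, so minors at two different
parameters agree up to a scalar. As λ is injective on the unit circle, this expresses F(G) entirely
through the functions of its reductions. The trial has the same reductions, so F(G) ≃ F(G^ω);
faithfulness gives G ≅ G^ω, and in the symmetric group of degree two this forces both permutations
to be trivial. With three or more edges, triviality of all contractions forces triviality. Trivial
dimaps are classified by size, and contraction makes the set of sizes downward closed. Conversely,
(1, √2 - 1) is fixed by every M(μ), and a minor of its tensor power is the next lower power, because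
1 + λ(μ)(√2 - 1) ≠ 0 when |μ| = 1. -/

/-! ### Trivial alternating dimaps and their reductions -/

namespace AltDimap

/-- Both successor permutations are trivial: every edge is an ultraloop. -/
def IsTrivial (G : AltDimap.{u}) : Prop := G.left = 1 ∧ G.right = 1

lemma IsIso.card_eq {G H : AltDimap.{u}} (h : G.IsIso H) : Nat.card G.E = Nat.card H.E := by
  obtain ⟨φ, -, -⟩ := h
  exact Nat.card_congr φ

lemma IsIso.symm {G H : AltDimap.{u}} (h : G.IsIso H) : H.IsIso G := by
  obtain ⟨φ, hl, hr⟩ := h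
  refine ⟨φ.symm, fun e => ?_, fun e => ?_⟩
  · rw [Equiv.symm_apply_eq, hl, Equiv.apply_symm_apply]
  · rw [Equiv.symm_apply_eq, hr, Equiv.apply_symm_apply]

lemma IsTrivial.of_isIso {G H : AltDimap.{u}} (hH : H.IsTrivial) (h : G.IsIso H) :
    G.IsTrivial := by
  obtain ⟨φ, hl, hr⟩ := h
  constructor
  · ext e
    apply φ.injective
    rw [hl, hH.1]; rfl
  · ext e
    apply φ.injective
    rw [hr, hH.2]; rfl

lemma IsTrivial.isIso_of_equiv {G H : AltDimap.{u}} (hG : G.IsTrivial) (hH : H.IsTrivial)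
    (φ : G.E ≃ H.E) : G.IsIso H :=
  ⟨φ, fun e => by rw [hG.1, hH.1]; rfl, fun e => by rw [hG.2, hH.2]; rfl⟩

lemma IsTrivial.isIso_of_card_eq {G H : AltDimap.{u}} (hG : G.IsTrivial) (hH : H.IsTrivial)
    (h : Nat.card G.E = Nat.card H.E) : G.IsIso H := by
  have := G.finite
  have := H.finite
  exact hG.isIso_of_equiv hH (Finite.card_eq.1 h).some

lemma isTrivial_copies_ultraloop (k : ℕ) : (copies k ultraloop.{u}).IsTrivial :=
  ⟨rfl, rfl⟩

lemma card_copies_ultraloop (k : ℕ) : Nat.card (copies k ultraloop.{u}).E = k := by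
  change Nat.card (Fin k × PUnit) = k
  simp

lemma isIso_copies_ultraloop_iff {G : AltDimap.{u}} {k : ℕ} :
    G.IsIso (copies k ultraloop) ↔ G.IsTrivial ∧ Nat.card G.E = k := by
  constructor
  · intro h
    exact ⟨(isTrivial_copies_ultraloop k).of_isIso h, h.card_eq.trans (card_copies_ultraloop k)⟩
  · rintro ⟨h, rfl⟩
    exact h.isIso_of_card_eq (isTrivial_copies_ultraloop _) (card_copies_ultraloop _).symm

lemma skip_one {E : Type u} (e : E) : (1 : Equiv.Perm E).skip e = 1 := by
  ext x
  simp [Equiv.Perm.skip]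

lemma IsTrivial.trial {G : AltDimap.{u}} (h : G.IsTrivial) : G.trial.IsTrivial := by
  constructor
  · change (G.right⁻¹ * G.left)⁻¹ = 1
    rw [h.1, h.2]; simp
  · change G.left⁻¹ = 1
    rw [h.1]; simp

lemma IsTrivial.reduce {G : AltDimap.{u}} (h : G.IsTrivial) (μ : Triality) (e : G.E) :
    (G.reduce μ e).IsTrivial := by
  have hn : G.nextIn = 1 := by rw [nextIn, h.1, h.2]; simp
  constructor <;> cases μ <;> simp [AltDimap.reduce, h.1, h.2, hn, skip_one] <;> rfl

lemma card_reduce (G : AltDimap.{u}) (μ : Triality) (e : G.E) :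
    Nat.card (G.reduce μ e).E + 1 = Nat.card G.E := by
  classical
  have := G.finite
  have := Fintype.ofFinite G.E
  change Nat.card {x : G.E // x ≠ e} + 1 = _
  have : 0 < Fintype.card G.E := Fintype.card_pos_iff.2 ⟨e⟩
  rw [Nat.card_eq_fintype_card, Nat.card_eq_fintype_card, Fintype.card_subtype_compl,
    Fintype.card_subtype_eq]
  omega

/-- A permutation that becomes trivial when any one element is skipped is trivial, provided that
there are at least three elements. -/
lemma eq_one_of_skip_eq_one {E : Type u} (h3 : 3 ≤ Nat.card E) (σ : Equiv.Perm E)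
    (h : ∀ e, σ.skip e = 1) : σ = 1 := by
  classical
  have : Finite E := Nat.finite_of_card_ne_zero (by omega)
  have := Fintype.ofFinite E
  ext a
  by_contra hab
  simp only [Equiv.Perm.coe_one, id_eq] at hab
  -- Skipping an element outside {a, σ a} keeps the arrow from a to σ a. With only two elements
  -- there is no such c, and a transposition would be a counterexample.
  obtain ⟨c, hc⟩ : ∃ c, c ∉ ({a, σ a} : Finset E) := by
    by_contra! hall
    have : Fintype.card E ≤ 2 := by
      rw [← Finset.card_univ]
      exact (Finset.card_le_card fun x _ => hall x).trans Finset.card_le_two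
    rw [Nat.card_eq_fintype_card] at h3
    omega
  simp only [Finset.mem_insert, Finset.mem_singleton, not_or] at hc
  have hs := congrArg (fun τ => ((τ ⟨a, Ne.symm hc.1⟩ : {x // x ≠ c}) : E)) (h c)
  have hne : σ a ≠ σ c := fun h => hc.1 (σ.injective h).symm
  simp only [Equiv.Perm.skip, Equiv.Perm.subtypePerm_apply, Equiv.Perm.mul_apply,
    Equiv.Perm.coe_one, id_eq] at hs
  rw [Equiv.swap_apply_of_ne_of_ne (Ne.symm hc.2) hne] at hs
  exact hab hs

lemma isTrivial_of_reduce {G : AltDimap.{u}} (h3 : 3 ≤ Nat.card G.E)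
    (h : ∀ e, (G.reduce .one e).IsTrivial) : G.IsTrivial :=
  ⟨eq_one_of_skip_eq_one h3 _ fun e => (h e).1, eq_one_of_skip_eq_one h3 _ fun e => (h e).2⟩

lemma isTrivial_of_card_le_one {G : AltDimap.{u}} (h : Nat.card G.E ≤ 1) : G.IsTrivial := by
  have := G.finite
  have : Subsingleton G.E := Finite.card_le_one_iff_subsingleton.1 h
  exact ⟨Subsingleton.elim _ _, Subsingleton.elim _ _⟩

/-- The group is commutative of exponent two, so φ cancels: the first equation gives r = 1, and then
the second gives l = 1. -/
lemma perm_eq_one_of_trial {E : Type u} (hE : Nat.card E = 2) (l r φ : Equiv.Perm E)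
    (hl : φ * l = (r⁻¹ * l)⁻¹ * φ) (hr : φ * r = l⁻¹ * φ) : l = 1 ∧ r = 1 := by
  have : Finite E := Nat.finite_of_card_ne_zero (by omega)
  let m := (Finite.equivFinOfCardEq hE).permCongrHom
  have key : ∀ l r φ : Equiv.Perm (Fin 2), φ * l = (r⁻¹ * l)⁻¹ * φ → φ * r = l⁻¹ * φ →
      l = 1 ∧ r = 1 := by decide
  have := key (m l) (m r) (m φ) (by simpa using congrArg m hl) (by simpa using congrArg m hr)
  simpa using this

lemma isTrivial_of_isIso_trial {G : AltDimap.{u}} (hE : Nat.card G.E = 2)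
    (h : G.IsIso G.trial) : G.IsTrivial := by
  obtain ⟨φ, hl, hr⟩ := h
  exact perm_eq_one_of_trial hE G.left G.right φ (Equiv.ext hl) (Equiv.ext hr)

/-- With two edges, a reduction depends on the edge set and the edge only. -/
lemma reduce_eq_of_card_eq_two {E : Type u} {fin fin' : Finite E} (hE : Nat.card E = 2)
    (l r l' r' : Equiv.Perm E) (μ μ' : Triality) (e : E) :
    (AltDimap.mk E fin l r).reduce μ e = (AltDimap.mk E fin' l' r').reduce μ' e := by
  have hc := card_reduce (AltDimap.mk E fin l r) μ e
  have hc' : Nat.card {x : E // x ≠ e} + 1 = Nat.card E := hc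
  have : Subsingleton {x : E // x ≠ e} := Finite.card_le_one_iff_subsingleton.1 (by omega)
  unfold AltDimap.reduce
  congr 1 <;> exact Subsingleton.elim _ _

end AltDimap

/-! ### Minor-closed classes of trivial dimaps -/

open AltDimap

lemma mem_ultraloopClass_iff {k : ℕ} {G : AltDimap.{u}} :
    G ∈ ultraloopClass k ↔ G.IsTrivial ∧ Nat.card G.E ≤ k := by
  simp only [ultraloopClass, Set.mem_ofPred_eq, isIso_copies_ultraloop_iff]
  constructor
  · rintro ⟨i, hi, h, rfl⟩
    exact ⟨h, hi⟩
  · rintro ⟨h, hi⟩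
    exact ⟨_, hi, h, rfl⟩

lemma mem_ultraloopClassInfinite_iff {G : AltDimap.{u}} :
    G ∈ ultraloopClassInfinite ↔ G.IsTrivial := by
  simp only [ultraloopClassInfinite, Set.mem_ofPred_eq, isIso_copies_ultraloop_iff]
  exact ⟨fun ⟨_, h, _⟩ => h, fun h => ⟨_, h, rfl⟩⟩

lemma IsMinorClosed.exists_card_eq {A : Set AltDimap.{u}} (hA : IsMinorClosed A) {n : ℕ} :
    ∀ {G : AltDimap.{u}}, G ∈ A → n ≤ Nat.card G.E → ∃ H ∈ A, Nat.card H.E = n := by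
  intro G hG hn
  obtain ⟨d, hd⟩ := Nat.exists_eq_add_of_le hn
  induction d generalizing G with
  | zero => exact ⟨G, hG, hd⟩
  | succ d ih =>
    have := G.finite
    obtain ⟨e⟩ : Nonempty G.E := (Nat.card_pos_iff.1 (by omega)).1
    have := G.card_reduce .one e
    exact ih (hA.reduce hG .one e) (by omega) (by omega)

/-- A minor-closed class of trivial alternating dimaps is determined by the sizes of its members. -/
lemma IsMinorClosed.isUltraloopClass {A : Set AltDimap.{u}} (hA : IsMinorClosed A)
    (h : ∀ G ∈ A, G.IsTrivial) : IsUltraloopClass A := by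
  -- Contract G down to the size of H; trivial dimaps of equal size are isomorphic.
  have mem : ∀ {G H : AltDimap.{u}}, G ∈ A → H.IsTrivial → Nat.card H.E ≤ Nat.card G.E →
      H ∈ A := by
    intro G H hG hH hle
    obtain ⟨K, hK, hc⟩ := hA.exists_card_eq hG hle
    exact hA.iso hK ((h K hK).isIso_of_card_eq hH hc)
  rcases A.eq_empty_or_nonempty with h0 | ⟨G₀, hG₀⟩
  · exact Or.inl h0
  right
  by_cases hb : BddAbove ((fun G : AltDimap.{u} => Nat.card G.E) '' A)
  · left
    obtain ⟨G, hG, hmax⟩ := Nat.sSup_mem (Set.Nonempty.image _ ⟨G₀, hG₀⟩) hb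
    refine ⟨Nat.card G.E, Set.ext fun H => ?_⟩
    rw [mem_ultraloopClass_iff]
    refine ⟨fun hH => ⟨h H hH, ?_⟩, fun hH => mem hG hH.1 hH.2⟩
    exact (le_csSup hb ⟨H, hH, rfl⟩).trans_eq hmax.symm
  · right
    ext H
    rw [mem_ultraloopClassInfinite_iff]
    refine ⟨h H, fun hH => ?_⟩
    rw [not_bddAbove_iff] at hb
    obtain ⟨_, ⟨G, hG, rfl⟩, hlt⟩ := hb (Nat.card H.E)
    exact mem hG hH hlt.le

lemma isMinorClosed_of_isUltraloopClass {A : Set AltDimap.{u}} (h : IsUltraloopClass A) :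
    IsMinorClosed A := by
  rcases h with rfl | ⟨k, rfl⟩ | rfl
  · exact ⟨fun h => h.elim, fun h => h.elim⟩
  · refine ⟨fun {G H} hG hiso => ?_, fun {G} hG μ e => ?_⟩ <;>
      rw [mem_ultraloopClass_iff] at hG ⊢
    · exact ⟨hG.1.of_isIso hiso.symm, hiso.card_eq ▸ hG.2⟩
    · have := G.card_reduce μ e
      exact ⟨hG.1.reduce μ e, by omega⟩
  · refine ⟨fun {G H} hG hiso => ?_, fun {G} hG μ e => ?_⟩ <;>
      rw [mem_ultraloopClassInfinite_iff] at hG ⊢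
    · exact hG.of_isIso hiso.symm
    · exact hG.reduce μ e

lemma IsUltraloopClass.isTrivial {A : Set AltDimap.{u}} (h : IsUltraloopClass A)
    {G : AltDimap.{u}} (hG : G ∈ A) : G.IsTrivial := by
  rcases h with rfl | ⟨k, rfl⟩ | rfl
  · exact hG.elim
  · exact (mem_ultraloopClass_iff.1 hG).1
  · exact mem_ultraloopClassInfinite_iff.1 hG

/-! ### The numbers λ(μ) and the matrix M(μ) -/

section Complex

lemma norm_cubeRoot : ‖cubeRoot‖ = 1 := by
  rw [cubeRoot, show (2 * Real.pi * Complex.I / 3 : ℂ) = ((2 * Real.pi / 3 : ℝ) : ℂ) * Complex.I by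
    push_cast; ring]
  exact Complex.norm_exp_ofReal_mul_I _

lemma cubeRoot_ne_one : cubeRoot ≠ 1 :=
  (Complex.isPrimitiveRoot_exp 3 (by norm_num)).ne_one (by norm_num)

lemma norm_toComplex (μ : Triality) : ‖μ.toComplex‖ = 1 := by
  cases μ <;> simp [Triality.toComplex, norm_cubeRoot]

lemma sqrt_two_mul_self : (√2 : ℂ) * (√2 : ℂ) = 2 := by
  rw [← Complex.ofReal_mul, Real.mul_self_sqrt (by norm_num)]
  norm_num

lemma sqrt_two_ne_zero : (√2 : ℂ) ≠ 0 := by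
  intro h
  have := sqrt_two_mul_self
  rw [h] at this
  norm_num at this

/-- Taking moduli in a vanishing denominator would give √2 + 1 = √2 - 1. -/
lemma minorCoeff_denom_ne_zero {μ : ℂ} (hμ : ‖μ‖ = 1) :
    (√2 : ℂ) + 1 - ((√2 : ℂ) - 1) * μ ≠ 0 := by
  intro h
  have h1 : (√2 : ℂ) + 1 = ((√2 : ℂ) - 1) * μ := sub_eq_zero.1 h
  have h2 := congrArg norm h1
  have hs : (1 : ℝ) ≤ √2 := Real.one_le_sqrt.2 (by norm_num)
  rw [norm_mul, hμ, mul_one,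
    show (√2 : ℂ) + 1 = ((√2 + 1 : ℝ) : ℂ) by push_cast; ring,
    show (√2 : ℂ) - 1 = ((√2 - 1 : ℝ) : ℂ) by push_cast; ring,
    Complex.norm_real, Complex.norm_real, Real.norm_of_nonneg (by linarith),
    Real.norm_of_nonneg (by linarith)] at h2
  linarith

/-- λ is a Möbius map of determinant 2√2. -/
lemma minorCoeff_injOn {μ μ' : ℂ} (hμ : ‖μ‖ = 1) (hμ' : ‖μ'‖ = 1)
    (h : minorCoeff μ = minorCoeff μ') : μ = μ' := by
  rw [minorCoeff, minorCoeff,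
    div_eq_div_iff (minorCoeff_denom_ne_zero hμ) (minorCoeff_denom_ne_zero hμ')] at h
  have h2 : (2 * (√2 : ℂ)) * (μ - μ') = 0 := by linear_combination h
  rcases mul_eq_zero.1 h2 with h3 | h3
  · simp at h3
  · exact sub_eq_zero.1 h3

/-- The μ-terms cancel in the numerator over the common denominator, leaving 2√2. This is the factor
by which an unnormalised minor scales a power of (1, √2 - 1). -/
lemma one_add_minorCoeff_mul_ne_zero {μ : ℂ} (hμ : ‖μ‖ = 1) :
    1 + minorCoeff μ * ((√2 : ℂ) - 1) ≠ 0 := by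
  have hd := minorCoeff_denom_ne_zero hμ
  have : 1 + minorCoeff μ * ((√2 : ℂ) - 1) =
      2 * (√2 : ℂ) / ((√2 : ℂ) + 1 - ((√2 : ℂ) - 1) * μ) := by
    rw [minorCoeff, div_mul_eq_mul_div, eq_div_iff hd, add_mul, div_mul_cancel₀ _ hd]
    ring
  rw [this]
  exact div_ne_zero (mul_ne_zero two_ne_zero sqrt_two_ne_zero) hd

/-- The vector `(1, √2 - 1)` is fixed by `M(μ)`. -/
lemma transformMatrix_mul_vector (μ : ℂ) (i : Fin 2) :
    ∑ j, transformMatrix μ i j * ![(1 : ℂ), (√2 : ℂ) - 1] j =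
      ![(1 : ℂ), (√2 : ℂ) - 1] i := by
  have h := sqrt_two_ne_zero
  have h2 := sqrt_two_mul_self
  fin_cases i <;> simp [transformMatrix, Fin.sum_univ_two]
  · field_simp
    ring
  · field_simp
    linear_combination (-1 + μ) * h2

end Complex

/-! ### Members of a representable class are trivial -/

section Forward

lemma BinaryFunction.preMinor_empty (f : BinaryFunction.{u}) (μ : ℂ) (e : f.E) :
    f.preMinor μ e ∅ = 1 + minorCoeff μ * f.val {e} := by
  simp [BinaryFunction.preMinor, f.val_empty]

lemma BinaryFunction.preMinor_univ (f : BinaryFunction.{u}) [DecidableEq f.E] (μ : ℂ)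
    (e : f.E) [Fintype {x : f.E // x ≠ e}] :
    f.preMinor μ e Finset.univ =
      f.val (Finset.univ.erase e) + minorCoeff μ * f.val Finset.univ := by
  have h : (Finset.univ : Finset {x : f.E // x ≠ e}).map (Function.Embedding.subtype _) =
      Finset.univ.erase e := by
    ext x; simp
  rw [BinaryFunction.preMinor, h]
  congr 3
  ext x
  simp [em]

/-- Every bijection of ground sets preserves ∅ and the full set, so comparing values there avoids
the unknown relabelling; the value at ∅ fixes the scalar as 1. -/
lemma Simeq.val_univ_mul {h f : BinaryFunction.{u}} [DecidableEq f.E] {μ : ℂ} {e : f.E}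
    (hs : Simeq h.val (f.minor μ e)) :
    h.val Finset.univ * (1 + minorCoeff μ * f.val {e}) =
      f.val (Finset.univ.erase e) + minorCoeff μ * f.val Finset.univ := by
  obtain ⟨σ, c, -, hX⟩ := hs
  have := Fintype.ofFinite {x : f.E // x ≠ e}
  have h0 := hX ∅
  have h1 := hX Finset.univ
  rw [h.val_empty, Finset.map_empty, BinaryFunction.minor, f.preMinor_empty] at h0
  rw [Finset.map_univ_equiv, BinaryFunction.minor, f.preMinor_empty, f.preMinor_univ] at h1
  -- Otherwise the minor is the zero function, since 0⁻¹ = 0, contradicting the value 1 at ∅.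
  have hne : 1 + minorCoeff μ * f.val {e} ≠ 0 := by
    intro hz
    rw [hz] at h0
    simp at h0
  rw [inv_mul_cancel₀ hne, mul_one] at h0
  rw [h1, ← h0, one_mul, mul_comm, mul_inv_cancel_left₀ hne]

/-- `Simeq.val_univ_mul` is affine in λ; holding at two distinct values of λ, it holds
coefficientwise. -/
lemma Simeq.val_univ {h f : BinaryFunction.{u}} [DecidableEq f.E] {μ μ' : ℂ} {e : f.E}
    (hμ : ‖μ‖ = 1) (hμ' : ‖μ'‖ = 1) (hne : μ ≠ μ')
    (hs : Simeq h.val (f.minor μ e)) (hs' : Simeq h.val (f.minor μ' e)) :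
    f.val (Finset.univ.erase e) = h.val Finset.univ ∧
      f.val Finset.univ = h.val Finset.univ * f.val {e} := by
  have h1 := hs.val_univ_mul
  have h2 := hs'.val_univ_mul
  have hl : minorCoeff μ - minorCoeff μ' ≠ 0 :=
    sub_ne_zero.2 fun h => hne (minorCoeff_injOn hμ hμ' h)
  have h3 : f.val Finset.univ = h.val Finset.univ * f.val {e} := by
    apply mul_left_cancel₀ hl
    linear_combination h2 - h1
  exact ⟨by linear_combination (-1 : ℂ) * h1 - minorCoeff μ * h3, h3⟩

/-- On a ground set with two elements, the values considered here determine a binary function. -/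
lemma simeqVia_of_card_eq_two {f g : BinaryFunction.{u}} [DecidableEq f.E] [DecidableEq g.E]
    (hc : Fintype.card f.E = 2) (σ : f.E ≃ g.E) (a : f.E → ℂ)
    (hf : ∀ e, f.val (Finset.univ.erase e) = a e ∧ f.val Finset.univ = a e * f.val {e})
    (hg : ∀ e, g.val (Finset.univ.erase (σ e)) = a e ∧
      g.val Finset.univ = a e * g.val {σ e}) :
    SimeqVia σ f.val g.val := by
  have erase_eq : ∀ e, f.val (Finset.univ.erase e) =
      g.val ((Finset.univ.erase e).map σ.toEmbedding) := by
    intro e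
    have : (Finset.univ.erase e).map σ.toEmbedding = Finset.univ.erase (σ e) := by
      rw [Finset.map_erase, Finset.map_univ_equiv]; rfl
    rw [this, (hf e).1, (hg e).1]
  -- In a two-element set, a singleton is the complement of the other one.
  have one : ∀ X : Finset f.E, X.card = 1 → f.val X = g.val (X.map σ.toEmbedding) := by
    intro X hX
    have hXc : Xᶜ.card = 1 := by rw [Finset.card_compl, hc, hX]
    obtain ⟨e, he⟩ := Finset.card_eq_one.1 hXc
    have : X = Finset.univ.erase e := by
      rw [← compl_compl X, he, Finset.compl_singleton]
    rw [this, erase_eq]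
  refine ⟨1, one_ne_zero, fun X => ?_⟩
  rw [one_mul]
  have hle : X.card ≤ 2 := hc ▸ Finset.card_le_univ X
  interval_cases hX : X.card
  · rw [Finset.card_eq_zero.1 hX, Finset.map_empty, f.val_empty, g.val_empty]
  · exact one X hX
  · obtain rfl : X = Finset.univ := Finset.eq_univ_of_card X (hX.trans hc.symm)
    obtain ⟨e⟩ : Nonempty f.E := Fintype.card_pos_iff.1 (by omega)
    rw [Finset.map_univ_equiv, (hf e).2, (hg e).2, one {e} (Finset.card_singleton e),
      Finset.map_singleton]
    rfl

namespace StrictBinaryRepresentation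

variable {A : Set AltDimap.{u}} {hA : IsMinorClosed A}

/-- G and its trial share their edge set, hence all their reductions, and these determine F on two
edges up to ≃. -/
lemma isIso_trial (R : StrictBinaryRepresentation A hA) (G : A) (hE : Nat.card G.1.E = 2) :
    G.1.IsIso G.1.trial := by
  classical
  let T : A := ⟨G.1.trial, R.trial_mem G⟩
  let h : G.1.E → BinaryFunction.{u} := fun e => R.F ⟨G.1.reduce .one e, hA.reduce G.2 .one e⟩
  have hν (μ : Triality) : ‖R.ν * μ.toComplex‖ = 1 := by
    rw [norm_mul, R.norm_ν, norm_toComplex, one_mul]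
  have hν0 : R.ν ≠ 0 := fun h0 => by simpa [h0] using R.norm_ν
  have hne : R.ν * Triality.one.toComplex ≠ R.ν * Triality.omega.toComplex := fun heq =>
    cubeRoot_ne_one (mul_left_cancel₀ hν0 heq).symm
  have hG : ∀ (e : G.1.E) (μ : Triality),
      Simeq (h e).val ((R.F G).minor (R.ν * μ.toComplex) (R.ε G e)) := by
    intro e μ
    -- Equality, not just isomorphism, is needed: F is not assumed to respect isomorphism.
    have hred : G.1.reduce .one e = G.1.reduce μ e :=
      reduce_eq_of_card_eq_two (fin := G.1.finite) (fin' := G.1.finite) hE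
        G.1.left G.1.right G.1.left G.1.right .one μ e
    have heq : (⟨G.1.reduce .one e, hA.reduce G.2 .one e⟩ : A) =
        ⟨G.1.reduce μ e, hA.reduce G.2 μ e⟩ := Subtype.ext hred
    change Simeq (R.F _).val _
    rw [heq]
    exact R.reduce G e μ
  have hT : ∀ (e : G.1.E) (μ : Triality),
      Simeq (h e).val ((R.F T).minor (R.ν * μ.toComplex) (R.ε T e)) := by
    intro e μ
    have hred : G.1.reduce .one e = T.1.reduce μ e :=
      reduce_eq_of_card_eq_two (fin := G.1.finite) (fin' := G.1.finite) hE
        G.1.left G.1.right T.1.left T.1.right .one μ e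
    have heq : (⟨G.1.reduce .one e, hA.reduce G.2 .one e⟩ : A) =
        ⟨T.1.reduce μ e, hA.reduce T.2 μ e⟩ := Subtype.ext hred
    change Simeq (R.F _).val _
    rw [heq]
    exact R.reduce T e μ
  have hc : Fintype.card (R.F G).E = 2 := by
    rw [← Nat.card_eq_fintype_card, ← hE, Nat.card_congr (R.ε G)]
  refine R.faithful G T ⟨(R.ε G).symm.trans (R.ε T), simeqVia_of_card_eq_two hc _
    (fun x => (h ((R.ε G).symm x)).val Finset.univ) (fun x => ?_) fun x => ?_⟩
  · obtain ⟨e, rfl⟩ := (R.ε G).surjective x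
    rw [Equiv.symm_apply_apply]
    exact Simeq.val_univ (hν _) (hν _) hne (hG e .one) (hG e .omega)
  · obtain ⟨e, rfl⟩ := (R.ε G).surjective x
    change (R.F T).val (Finset.univ.erase (R.ε T ((R.ε G).symm (R.ε G e)))) = _ ∧
      _ = _ * (R.F T).val {R.ε T ((R.ε G).symm (R.ε G e))}
    rw [Equiv.symm_apply_apply]
    exact Simeq.val_univ (hν _) (hν _) hne (hT e .one) (hT e .omega)

lemma isTrivial (R : StrictBinaryRepresentation A hA) {G : AltDimap.{u}} (hG : G ∈ A) :
    G.IsTrivial := by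
  induction hn : Nat.card G.E using Nat.strong_induction_on generalizing G with
  | _ n ih =>
    subst hn
    rcases le_or_gt (Nat.card G.E) 1 with h1 | h1
    · exact isTrivial_of_card_le_one h1
    rcases eq_or_lt_of_le (Nat.succ_le_of_lt h1) with h2 | h2
    · exact isTrivial_of_isIso_trial h2.symm (R.isIso_trial ⟨G, hG⟩ h2.symm)
    · refine isTrivial_of_reduce h2 fun e => ?_
      have := G.card_reduce .one e
      exact ih _ (by omega) (hA.reduce hG .one e) rfl

end StrictBinaryRepresentation

end Forward

/-! ### The representation of the ultraloop classes -/

section Converse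

/-- The value at `X` of the vector `(1, √2 - 1)^{⊗E}`. -/
noncomputable def ultraloopValue {E : Type u} [Fintype E] (X : Finset E) : ℂ :=
  ∏ e, ![(1 : ℂ), (√2 : ℂ) - 1] (bit X e)

lemma ultraloopValue_empty {E : Type u} [Fintype E] : ultraloopValue (∅ : Finset E) = 1 := by
  simp [ultraloopValue, bit]

/-- The binary function `(1, √2 - 1)^{⊗E}`. -/
noncomputable def ultraloopFunction (E : Type u) [Fintype E] : BinaryFunction.{u} where
  E := E
  fintype := inferInstance
  val := ultraloopValue
  val_empty := ultraloopValue_empty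

lemma ultraloopFunction_transform (E : Type u) [Fintype E] (μ : ℂ) (X : Finset E) :
    (ultraloopFunction E).transform μ X = (ultraloopFunction E).val X := by
  classical
  -- Distributivity, with subsets identified with bit vectors: a tensor power of a matrix acts on a
  -- product vector factor by factor.
  have hY : ∀ g : E → Fin 2 → ℂ,
      ∑ Y : Finset E, ∏ e, g e (bit Y e) = ∏ e, ∑ j, g e j := by
    intro g
    rw [Fintype.prod_sum]
    refine Fintype.sum_bijective (fun Y : Finset E => fun e => bit Y e) ⟨?_, ?_⟩ _ _ fun _ => rfl
    · intro Y Z h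
      ext e
      have := congrFun h e
      by_cases h1 : e ∈ Y <;> by_cases h2 : e ∈ Z <;> simp_all [bit]
    · intro p
      refine ⟨Finset.univ.filter fun e => p e = 1, funext fun e => ?_⟩
      simp only [bit, Finset.mem_filter, Finset.mem_univ, true_and]
      split_ifs <;> omega
  change ∑ Y : Finset E, (∏ e : E, transformMatrix μ (bit X e) (bit Y e)) *
    ∏ e, ![(1 : ℂ), (√2 : ℂ) - 1] (bit Y e) = ∏ e, ![(1 : ℂ), (√2 : ℂ) - 1] (bit X e)
  simp_rw [← Finset.prod_mul_distrib]
  rw [hY fun e j => transformMatrix μ (bit X e) j * ![(1 : ℂ), (√2 : ℂ) - 1] j]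
  exact Finset.prod_congr rfl fun e _ => transformMatrix_mul_vector μ _

lemma ultraloopValue_map_subtype {E : Type u} [Fintype E] {e : E} [Fintype {x : E // x ≠ e}]
    (X : Finset {x : E // x ≠ e}) :
    ultraloopValue (X.map (Function.Embedding.subtype _)) = ultraloopValue X := by
  classical
  have hb : ∀ x : {x : E // x ≠ e},
      bit (X.map (Function.Embedding.subtype _)) (x : E) = bit X x := fun x => by
    simp [bit, x.2]
  have he : bit (X.map (Function.Embedding.subtype (· ≠ e))) e = 0 := by simp [bit]
  rw [ultraloopValue, Fintype.prod_eq_mul_prod_subtype_ne _ e, he]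
  simp_rw [hb]
  rw [Matrix.cons_val_zero, one_mul, ultraloopValue]
  congr!

lemma ultraloopValue_insert_map_subtype {E : Type u} [Fintype E] [DecidableEq E] {e : E}
    [Fintype {x : E // x ≠ e}] (X : Finset {x : E // x ≠ e}) :
    ultraloopValue (insert e (X.map (Function.Embedding.subtype _))) =
      ((√2 : ℂ) - 1) * ultraloopValue X := by
  have hb : ∀ x : {x : E // x ≠ e},
      bit (insert e (X.map (Function.Embedding.subtype _))) (x : E) = bit X x := fun x => by
    simp [bit, x.2]
  have he : bit (insert e (X.map (Function.Embedding.subtype (· ≠ e)))) e = 1 := by simp [bit]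
  rw [ultraloopValue, Fintype.prod_eq_mul_prod_subtype_ne _ e, he]
  simp_rw [hb]
  rw [Matrix.cons_val_one, Matrix.cons_val_zero, ultraloopValue]
  congr!

lemma ultraloopFunction_preMinor (E : Type u) [Fintype E] (e : E) [Fintype {x : E // x ≠ e}]
    (μ : ℂ) (X : Finset {x : E // x ≠ e}) :
    (ultraloopFunction E).preMinor μ e X =
      (1 + minorCoeff μ * ((√2 : ℂ) - 1)) * ultraloopValue X := by
  classical
  refine (congrArg₂ (fun a b => a + minorCoeff μ * b) (ultraloopValue_map_subtype X)
    (ultraloopValue_insert_map_subtype X)).trans ?_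
  ring

lemma ultraloopFunction_minor (E : Type u) [Fintype E] (e : E) [Fintype {x : E // x ≠ e}]
    {μ : ℂ} (hμ : ‖μ‖ = 1) (X : Finset {x : E // x ≠ e}) :
    (ultraloopFunction E).minor μ e X = ultraloopValue X := by
  refine (congrArg₂ (fun a b => a⁻¹ * b) (ultraloopFunction_preMinor E e μ ∅)
    (ultraloopFunction_preMinor E e μ X)).trans ?_
  rw [ultraloopValue_empty, mul_one, inv_mul_cancel_left₀ (one_add_minorCoeff_mul_ne_zero hμ)]

/-- The bijection is a variable with a proof that it is the identity, so that the composites of the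
`ε` in `IsEdgeCompatible` fit, with `rfl` as that proof. -/
lemma SimeqVia.of_eq {D : Type u} {σ : D ≃ D} (hσ : σ = Equiv.refl D) {f g : Finset D → ℂ}
    (h : ∀ X, f X = g X) : SimeqVia σ f g := by
  subst hσ
  refine ⟨1, one_ne_zero, fun X => ?_⟩
  rw [one_mul, h]
  congr 1
  exact Finset.map_refl.symm

/-- The binary function of a trivial alternating dimap, with the edges as ground set. -/
noncomputable def AltDimap.binaryFunction (G : AltDimap.{u}) : BinaryFunction.{u} :=
  haveI := G.finite
  letI := Fintype.ofFinite G.E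
  ultraloopFunction G.E

lemma AltDimap.simeqVia_trial (G : AltDimap.{u}) (μ : ℂ) (σ : G.E ≃ G.E)
    (hσ : σ = Equiv.refl _) :
    SimeqVia σ G.trial.binaryFunction.val (G.binaryFunction.transform μ) :=
  SimeqVia.of_eq hσ fun X => by
    have := G.finite
    let := Fintype.ofFinite G.E
    exact (ultraloopFunction_transform G.E μ X).symm

lemma AltDimap.simeqVia_reduce (G : AltDimap.{u}) {ν : ℂ} (hν : ‖ν‖ = 1) (e : G.E)
    (μ : Triality) (σ : {x : G.E // x ≠ e} ≃ {x : G.E // x ≠ e}) (hσ : σ = Equiv.refl _) :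
    SimeqVia σ (G.reduce μ e).binaryFunction.val
      (BinaryFunction.minor G.binaryFunction ν e) :=
  SimeqVia.of_eq hσ fun X => by
    have := G.finite
    let := Fintype.ofFinite G.E
    let := Fintype.ofFinite {x : G.E // x ≠ e}
    exact (ultraloopFunction_minor G.E e hν X).symm

lemma IsUltraloopClass.trial_mem {A : Set AltDimap.{u}} (h : IsUltraloopClass A)
    {G : AltDimap.{u}} (hG : G ∈ A) : G.trial ∈ A :=
  (isMinorClosed_of_isUltraloopClass h).iso hG
    ((h.isTrivial hG).isIso_of_equiv (h.isTrivial hG).trial (Equiv.refl G.E))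

lemma norm_one_mul_toComplex (μ : Triality) : ‖1 * μ.toComplex‖ = 1 := by
  rw [one_mul, norm_toComplex]

/-- The representation of a class of ultraloops by the powers of `(1, √2 - 1)`. -/
noncomputable def ultraloopRepresentation {A : Set AltDimap.{u}} (h : IsUltraloopClass A) :
    StrictBinaryRepresentation A (isMinorClosed_of_isUltraloopClass h) where
  F G := G.1.binaryFunction
  ε _ := Equiv.refl _
  ν := 1
  norm_ν := norm_one
  trial_mem G := h.trial_mem G.2
  trial G := ⟨Equiv.refl G.1.E, G.1.simeqVia_trial _ _ rfl⟩
  reduce G e μ := ⟨Equiv.refl {x : G.1.E // x ≠ e},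
    G.1.simeqVia_reduce (norm_one_mul_toComplex μ) e μ _ rfl⟩
  -- For trivial dimaps any bijection of edges is an isomorphism, so the sizes of the ground sets
  -- suffice.
  faithful G H := fun ⟨σ, _⟩ => (h.isTrivial G.2).isIso_of_equiv (h.isTrivial H.2) σ

lemma ultraloopRepresentation_isEdgeCompatible {A : Set AltDimap.{u}} (h : IsUltraloopClass A) :
    (ultraloopRepresentation h).IsEdgeCompatible :=
  ⟨fun G => G.1.simeqVia_trial _ _ rfl,
    fun G e μ => G.1.simeqVia_reduce (norm_one_mul_toComplex μ) e μ _ rfl⟩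

end Converse

theorem mainTheorem3 :
    (∀ (A : Set AltDimap.{u}) (hA : IsMinorClosed A),
      Nonempty (StrictBinaryRepresentation A hA) → IsUltraloopClass A) ∧
    (∀ A : Set AltDimap.{u}, IsUltraloopClass A →
      ∃ (hA : IsMinorClosed A) (R : StrictBinaryRepresentation A hA),
        R.IsEdgeCompatible ∧
        ∀ (G : A) (X : Finset (R.F G).E),
          (R.F G).val X = ∏ e : (R.F G).E, ![(1 : ℂ), (√2 : ℂ) - 1] (bit X e)) := by
  refine ⟨fun A hA ⟨R⟩ => hA.isUltraloopClass fun G hG => R.isTrivial hG, fun A h =>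
    ⟨isMinorClosed_of_isUltraloopClass h, ultraloopRepresentation h,
      ultraloopRepresentation_isEdgeCompatible h, fun G X => rfl⟩⟩
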